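/- Let $\Bbbk$ be a field, $R=\Bbbk[x_1,\dots,x_n]$, let $I\subseteq R$ be a squarefree monomial ideal (an ideal generated by squarefree monomials), and let $u\in\mathbb{Q}_{>0}$. Write $\overline{J}$ for the integral closure of an ideal $J$, and $\operatorname{Ass}(I)$ for the set of associated primes of $R/I$. Write $u=p/q$ with positive integers $p,q$; the $u$-th rational power of $I$ is $\overline{I^u}=\{f\in R : f^q\in\overline{I^p}\}$ (it does not depend on the choice of $p,q$), and the $u$-th rational symbolic power of $I$ is $$\overline{I^{(u)}}=\bigcap_{\mathfrak p\in\operatorname{Ass}(I)}\bigl(\overline{I^u}R_{\mathfrak p}\cap R\bigr),$$ where the empty intersection is $R$. For an ideal $J\subseteq R$ let $\mathrm{NP}(J)\subseteq\mathbb{R}^n_{\ge 0}$ be the convex hull of $\{\mathbf a\in\mathbb{Z}_{\ge 0}^n : x^{\mathbf a}\in J\}$, and let the symbolic polyhedron of $I$ be $\mathrm{SP}(I)=\bigcap_{\mathfrak p\in\operatorname{Ass}(I)}\mathrm{NP}(\mathfrak p)\subseteq\mathbb{R}^n_{\ge 0}$, where the empty intersection is $\mathbb{R}^n_{\ge 0}$.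 Then $$\overline{I^{(u)}}=\bigl\langle\, x^{\mathbf a} : \mathbf a\in\mathbb{Z}_{\ge 0}^n,\ \mathbf a\in u\cdot\mathrm{SP}(I)\,\bigr\rangle .$$ -/

import Mathlib

open scoped Pointwise

namespace RatSymb

section IntegralClosure

variable {R : Type*} [CommRing R]

/-- `x` is integral over the ideal `I`: it satisfies an equation
`x ^ n + a 1 * x ^ (n - 1) + ⋯ + a n = 0` with `n ≥ 1` and `a i ∈ I ^ i`. -/
def IsIntegralOver (I : Ideal R) (x : R) : Prop :=
  ∃ n : ℕ, 0 < n ∧ ∃ a : ℕ → R, (∀ i ∈ Finset.Icc 1 n, a i ∈ I ^ i) ∧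
    x ^ n + ∑ i ∈ Finset.Icc 1 n, a i * x ^ (n - i) = 0

/-- Integrality over a power of an ideal, read off in the Rees algebra. -/
theorem isIntegralOver_pow_iff (I : Ideal R) (m : ℕ) (x : R) :
    IsIntegralOver (I ^ m) x ↔ IsIntegral (reesAlgebra I) (Polynomial.monomial m x) := by
  constructor
  · rintro ⟨n, hn, a, ha, h⟩
    have hmem : ∀ i, Polynomial.monomial (m * i) (if i ∈ Finset.Icc 1 n then a i else 0) ∈
        reesAlgebra I := by
      intro i
      refine reesAlgebra.monomial_mem.mpr ?_
      split_ifs with hi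
      · rw [pow_mul]; exact ha i hi
      · exact zero_mem _
    let c : ℕ → reesAlgebra I := fun i => ⟨_, hmem i⟩
    refine ⟨Polynomial.X ^ n + ∑ i ∈ Finset.Icc 1 n,
      Polynomial.C (c i) * Polynomial.X ^ (n - i), ?_, ?_⟩
    · refine Polynomial.monic_X_pow_add ?_
      refine (Polynomial.degree_sum_le _ _).trans_lt ?_
      rw [Finset.sup_lt_iff (by exact WithBot.bot_lt_coe n)]
      intro i hi
      refine (Polynomial.degree_C_mul_X_pow_le _ _).trans_lt ?_
      rw [Finset.mem_Icc] at hi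
      exact_mod_cast (by omega : n - i < n)
    · rw [Polynomial.eval₂_add, Polynomial.eval₂_finsetSum, Polynomial.eval₂_X_pow,
        Polynomial.monomial_pow]
      have : ∀ i ∈ Finset.Icc 1 n, Polynomial.eval₂ (algebraMap (reesAlgebra I) (Polynomial R))
          (Polynomial.monomial m x) (Polynomial.C (c i) * Polynomial.X ^ (n - i)) =
          Polynomial.monomial (m * n) (a i * x ^ (n - i)) := by
        intro i hi
        rw [Polynomial.eval₂_mul, Polynomial.eval₂_C, Polynomial.eval₂_X_pow,
          Polynomial.monomial_pow]
        change Polynomial.monomial (m * i) (if i ∈ Finset.Icc 1 n then a i else 0) * _ = _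
        rw [if_pos hi, Polynomial.monomial_mul_monomial, ← mul_add]
        rw [Finset.mem_Icc] at hi
        rw [Nat.add_sub_cancel' hi.2]
      rw [Finset.sum_congr rfl this, ← map_sum, ← map_add, h, map_zero]
  · rintro ⟨P, hP, h⟩
    -- multiply by the variable, so that the degree is positive
    have hQ : (P * Polynomial.X).Monic := hP.mul Polynomial.monic_X
    have hQ0 : Polynomial.eval₂ (algebraMap (reesAlgebra I) (Polynomial R))
        (Polynomial.monomial m x) (P * Polynomial.X) = 0 := by
      rw [Polynomial.eval₂_mul, h, zero_mul]
    set Q := P * Polynomial.X with hQdef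
    set n := P.natDegree + 1 with hn
    have hdeg : Q.natDegree ≤ n := by
      refine Polynomial.natDegree_mul_le.trans ?_
      have := Polynomial.natDegree_X_le (R := reesAlgebra I)
      omega
    have hlead : Q.coeff n = 1 := by
      rw [hQdef, hn, Polynomial.coeff_mul_X]; exact hP
    refine ⟨n, Nat.succ_pos _, fun i => ((Q.coeff (n - i) : reesAlgebra I) :
      Polynomial R).coeff (m * i), ?_, ?_⟩
    · intro i _
      rw [← pow_mul]
      exact (Q.coeff (n - i)).2 _
    · rw [Polynomial.eval₂_eq_sum_range' _ (Nat.lt_succ_of_le hdeg)] at hQ0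
      have hc := congrArg (fun f : Polynomial R => f.coeff (m * n)) hQ0
      simp only [Polynomial.finsetSum_coeff, Polynomial.coeff_zero] at hc
      rw [Finset.sum_range_succ, hlead, map_one, one_mul, Polynomial.monomial_pow,
        Polynomial.coeff_monomial, if_pos rfl, add_comm] at hc
      rw [← hc]
      congr 1
      refine Finset.sum_bij' (fun i _ => n - i) (fun j _ => n - j) ?_ ?_ ?_ ?_ ?_
      · intro i hi; rw [Finset.mem_Icc] at hi; rw [Finset.mem_range]; omega
      · intro j hj; rw [Finset.mem_range] at hj; rw [Finset.mem_Icc]; omega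
      · intro i hi; rw [Finset.mem_Icc] at hi; omega
      · intro j hj; rw [Finset.mem_range] at hj; omega
      · intro i hi
        rw [Finset.mem_Icc] at hi
        rw [Polynomial.monomial_pow, ← Polynomial.C_mul_X_pow_eq_monomial, ← mul_assoc,
          Polynomial.coeff_mul_X_pow', if_pos (Nat.mul_le_mul_left m (Nat.sub_le n i)),
          Polynomial.coeff_mul_C, ← Nat.mul_sub, Nat.sub_sub_self hi.2]
        rfl

theorem isIntegralOver_pow_add {I : Ideal R} {p q : ℕ} (hq : 0 < q) {x y : R}
    (hx : IsIntegralOver (I ^ p) (x ^ q)) (hy : IsIntegralOver (I ^ p) (y ^ q)) :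
    IsIntegralOver (I ^ p) ((x + y) ^ q) := by
  rw [isIntegralOver_pow_iff] at *
  rw [add_pow, map_sum]
  refine IsIntegral.sum _ fun i hi => ?_
  rw [Finset.mem_range] at hi
  have key : IsIntegral (reesAlgebra I) (Polynomial.monomial p (x ^ i * y ^ (q - i))) := by
    refine IsIntegral.of_pow hq ?_
    have : Polynomial.monomial p (x ^ i * y ^ (q - i)) ^ q =
        Polynomial.monomial p (x ^ q) ^ i * Polynomial.monomial p (y ^ q) ^ (q - i) := by
      rw [Polynomial.monomial_pow, Polynomial.monomial_pow, Polynomial.monomial_pow,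
        Polynomial.monomial_mul_monomial, ← mul_add, Nat.add_sub_cancel' (by omega),
        mul_pow, ← pow_mul, ← pow_mul, ← pow_mul, ← pow_mul, mul_comm i q, mul_comm (q - i) q]
    rw [this]
    exact (hx.pow _).mul (hy.pow _)
  rw [mul_comm, ← nsmul_eq_mul, map_nsmul]
  exact key.nsmul _

theorem isIntegralOver_pow_mul {I : Ideal R} {p q : ℕ} (r : R) {x : R}
    (hx : IsIntegralOver (I ^ p) (x ^ q)) : IsIntegralOver (I ^ p) ((r * x) ^ q) := by
  rw [isIntegralOver_pow_iff] at *
  rw [mul_pow, ← Polynomial.C_mul_monomial]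
  refine IsIntegral.mul ?_ hx
  exact isIntegral_algebraMap (R := reesAlgebra I) (x := algebraMap R (reesAlgebra I) (r ^ q))

theorem isIntegralOver_zero (I : Ideal R) : IsIntegralOver I 0 :=
  ⟨1, one_pos, 0, fun _ _ => zero_mem _, by simp⟩

/-- The integral closure of an ideal. -/
def idealClosure (I : Ideal R) : Ideal R where
  carrier := {x | IsIntegralOver I x}
  add_mem' {x y} hx hy := by
    have := isIntegralOver_pow_add (I := I) (p := 1) (q := 1) one_pos (x := x) (y := y)
    simp only [pow_one] at this
    exact this hx hy
  zero_mem' := isIntegralOver_zero I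
  smul_mem' r x hx := by
    have := isIntegralOver_pow_mul (I := I) (p := 1) (q := 1) r (x := x)
    simp only [pow_one] at this
    exact this hx

/-- The rational power of `I` with positive rational exponent `u = p / q`:
all `x` such that `x ^ q` lies in the integral closure of `I ^ p`.
The fraction is taken in lowest terms. -/
def ratPower (I : Ideal R) (u : ℚ) : Ideal R where
  carrier := {x | x ^ u.den ∈ idealClosure (I ^ u.num.toNat)}
  add_mem' hx hy := isIntegralOver_pow_add u.den_pos hx hy
  zero_mem' := by
    change (0 : R) ^ u.den ∈ idealClosure (I ^ u.num.toNat)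
    rw [zero_pow u.den_ne_zero]
    exact zero_mem _
  smul_mem' r _ hx := isIntegralOver_pow_mul r hx

/-- The rational power does not depend on the fraction that presents the exponent. -/
theorem mem_ratPower_iff (I : Ideal R) {u : ℚ} {p q : ℕ} (hq : 0 < q) (hu : u = p / q) (x : R) :
    x ∈ ratPower I u ↔ x ^ q ∈ idealClosure (I ^ p) := by
  change IsIntegralOver (I ^ u.num.toNat) (x ^ u.den) ↔ IsIntegralOver (I ^ p) (x ^ q)
  have hnum : (u.num.toNat : ℤ) = u.num := by
    refine Int.toNat_of_nonneg (Rat.num_nonneg.mpr ?_)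
    rw [hu]; positivity
  have hcross : u.num.toNat * q = p * u.den := by
    have h1 : (u.num : ℚ) / u.den = p / q := by rw [Rat.num_div_den, hu]
    rw [div_eq_div_iff (by exact_mod_cast u.den_ne_zero) (by exact_mod_cast hq.ne')] at h1
    rw [← hnum] at h1
    exact_mod_cast h1
  have key : Polynomial.monomial u.num.toNat (x ^ u.den) ^ q =
      Polynomial.monomial p (x ^ q) ^ u.den := by
    rw [Polynomial.monomial_pow, Polynomial.monomial_pow, hcross, ← pow_mul, ← pow_mul,
      mul_comm q u.den]
  rw [isIntegralOver_pow_iff, isIntegralOver_pow_iff, ← IsIntegral.pow_iff (n := q) hq, key,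
    IsIntegral.pow_iff u.den_pos]

/-- The rational symbolic power of `I`: the intersection, over the associated primes `P` of
`I` (that is, of the module `R ⧸ I`), of the contractions to `R` of the extensions of the rational
power of `I` to the localization at `P`. -/
def ratSymbolicPower (I : Ideal R) (u : ℚ) : Ideal R :=
  ⨅ (P : Ideal R) (_ : P.IsPrime) (_ : P ∈ associatedPrimes R (R ⧸ I)),
    ((ratPower I u).map (algebraMap R (Localization.AtPrime P))).comap
      (algebraMap R (Localization.AtPrime P))

end IntegralClosure

section Monomial

open MvPolynomial

variable {k : Type*} [Field k] {n : ℕ}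

/-- An exponent vector as a point of `ℝ ^ n`. -/
def expVec (a : Fin n →₀ ℕ) : Fin n → ℝ := fun i => (a i : ℝ)

/-- A squarefree monomial ideal: an ideal generated by squarefree monomials, that is,
by monomials all of whose exponents are at most `1`. -/
def IsSquarefreeMonomial (I : Ideal (MvPolynomial (Fin n) k)) : Prop :=
  ∃ S : Set (Fin n →₀ ℕ), (∀ a ∈ S, ∀ i, a i ≤ 1) ∧
    I = Ideal.span ((fun a => monomial a (1 : k)) '' S)

/-- The Newton polyhedron: the convex hull of the exponents of the monomials in `I`. -/
def newtonPolyhedron (I : Ideal (MvPolynomial (Fin n) k)) : Set (Fin n → ℝ) :=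
  convexHull ℝ (expVec '' {a | monomial a (1 : k) ∈ I})

/-- The symbolic polyhedron: the intersection, inside the nonnegative orthant, of the Newton
polyhedra of the associated primes of `I`. -/
def symbolicPolyhedron (I : Ideal (MvPolynomial (Fin n) k)) : Set (Fin n → ℝ) :=
  {v | (∀ i, 0 ≤ v i) ∧ ∀ P ∈ associatedPrimes (MvPolynomial (Fin n) k)
    (MvPolynomial (Fin n) k ⧸ I), v ∈ newtonPolyhedron P}

end Monomial

end RatSymb

namespace RatSymb

open MvPolynomial

/-! ### Orders of polynomials along coordinate primes. -/

section Order

variable {σ k : Type*} [Field k]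

/-! Every associated prime of a squarefree monomial ideal `I` is a coordinate prime `P = (x_i : i ∈
T)`, and the Newton polyhedron of `P` is cut out of the orthant by `∑_{i ∈ T} v_i ≥ 1`. So both
sides are governed by the inequalities `∑_{i ∈ T} a_i ≥ u`, one for each such `T`
(`expVec_mem_smul_symbolicPolyhedron_iff`).

These are necessary: `gradingHom` turns `T`-order into `t`-adic order in `R[t]`, where `t` is prime.
It sends `I` into `(t)`, integral closure preserves divisibility by powers of `t`, and a denominator
`s ∉ P` has order zero (`le_mul_sum_of_mul_mem_ratPower`).

They are sufficient: since `I` is radical, some `s ∉ P` satisfies `s P ⊆ I`, so `s ^ m` moves `P ^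
m` into `I ^ m` (`pow_mul_mem_ratPower`). -/

open Classical in
/-- The grading homomorphism that multiplies the variables in `T` by a new variable. -/
noncomputable def gradingHom (k : Type*) [Field k] (T : Finset σ) :
    MvPolynomial σ k →ₐ[k] Polynomial (MvPolynomial σ k) :=
  aeval fun i => if i ∈ T then Polynomial.monomial 1 (X i) else Polynomial.C (X i)

theorem gradingHom_monomial (T : Finset σ) (a : σ →₀ ℕ) (c : k) :
    gradingHom k T (monomial a c) = Polynomial.monomial (∑ i ∈ T, a i) (monomial a c) := by
  classical
  have hX : ∀ i, gradingHom k T (X i) =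
      Polynomial.X ^ (if i ∈ T then 1 else 0) * Polynomial.C (X i) := by
    intro i
    rw [gradingHom, aeval_X]
    split_ifs
    · rw [← Polynomial.C_mul_X_pow_eq_monomial, mul_comm]
    · simp
  have hsum : ∑ i ∈ T, a i = ∑ i ∈ a.support, (if i ∈ T then 1 else 0) * a i := by
    simp only [ite_mul, one_mul, zero_mul, ← Finset.sum_filter, Finset.filter_mem_eq_inter]
    refine (Finset.sum_subset Finset.inter_subset_right fun i hi hn => ?_).symm
    simpa [hi] using hn
  have hC : gradingHom k T (C c) = Polynomial.C (C c) := by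
    rw [← MvPolynomial.algebraMap_eq, AlgHom.commutes]
    rfl
  rw [monomial_eq, Finsupp.prod, map_mul, hC, map_prod]
  simp only [map_pow, hX, mul_pow, ← pow_mul, Finset.prod_mul_distrib]
  rw [Finset.prod_pow_eq_pow_sum, ← hsum, ← Polynomial.C_mul_X_pow_eq_monomial, map_mul, map_prod]
  simp only [map_pow]
  ring

theorem coeff_coeff_gradingHom (T : Finset σ) (f : MvPolynomial σ k) (m : ℕ) (a : σ →₀ ℕ) :
    ((gradingHom k T f).coeff m).coeff a = if ∑ i ∈ T, a i = m then f.coeff a else 0 := by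
  classical
  induction f using MvPolynomial.induction_on' with
  | monomial b c =>
    rw [gradingHom_monomial, Polynomial.coeff_monomial]
    by_cases hb : b = a
    · subst hb; split_ifs <;> simp
    · split_ifs <;> simp [coeff_monomial, hb]
  | add p q hp hq =>
    rw [map_add, Polynomial.coeff_add, coeff_add, hp, hq, coeff_add]
    split_ifs <;> simp

theorem X_pow_dvd_gradingHom_iff (T : Finset σ) (f : MvPolynomial σ k) (m : ℕ) :
    Polynomial.X ^ m ∣ gradingHom k T f ↔ ∀ a ∈ f.support, m ≤ ∑ i ∈ T, a i := by
  rw [Polynomial.X_pow_dvd_iff]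
  constructor
  · intro h a ha
    by_contra! hlt
    have := congrArg (coeff a) (h _ hlt)
    rw [coeff_coeff_gradingHom, if_pos rfl, coeff_zero] at this
    exact mem_support_iff.mp ha this
  · intro h d hd
    ext a
    rw [coeff_coeff_gradingHom, coeff_zero]
    split_ifs with ha
    · by_contra hne
      have := h a (mem_support_iff.mpr hne)
      omega
    · rfl

theorem mem_span_X_image_iff_X_dvd (T : Finset σ) (f : MvPolynomial σ k) :
    f ∈ Ideal.span (X '' (T : Set σ)) ↔ Polynomial.X ∣ gradingHom k T f := by
  rw [mem_ideal_span_X_image, ← pow_one (Polynomial.X : Polynomial (MvPolynomial σ k)),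
    X_pow_dvd_gradingHom_iff]
  refine forall₂_congr fun a _ => ?_
  rw [Nat.one_le_iff_ne_zero, Ne, Finset.sum_eq_zero_iff]
  push Not
  simp

/-- The ideal is the preimage of the prime ideal `(t)` under `gradingHom`. -/
theorem span_X_image_isPrime (T : Finset σ) :
    (Ideal.span (X '' (T : Set σ)) : Ideal (MvPolynomial σ k)).IsPrime where
  ne_top' h := by
    have h1 := (Ideal.eq_top_iff_one _).mp h
    rw [mem_span_X_image_iff_X_dvd, map_one] at h1
    exact Polynomial.prime_X.not_dvd_one h1
  mem_or_mem' {x y} h := by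
    rw [mem_span_X_image_iff_X_dvd, map_mul] at h
    simpa only [mem_span_X_image_iff_X_dvd] using Polynomial.prime_X.dvd_or_dvd h

/-- An element integral over a power of a principal prime ideal lies in that power. -/
theorem IsIntegralOver.prime_pow_dvd {A : Type*} [CommRing A] [IsDomain A] {t x : A}
    (ht : Prime t) {p : ℕ} (hx : IsIntegralOver (Ideal.span {t ^ p}) x) : t ^ p ∣ x := by
  obtain ⟨n, hn, a, ha, h⟩ := hx
  suffices ∀ m ≤ p, t ^ m ∣ x from this p le_rfl
  intro m
  induction m with
  | zero => simp
  | succ m ih =>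
    intro hm
    obtain ⟨y, rfl⟩ := ih (by omega)
    have hd : t ^ (m * n + 1) ∣ (t ^ m * y) ^ n := by
      rw [eq_neg_of_add_eq_zero_left h, dvd_neg]
      refine Finset.dvd_sum fun i hi => ?_
      have hai := ha i hi
      rw [Ideal.span_singleton_pow, Ideal.mem_span_singleton, ← pow_mul] at hai
      rw [Finset.mem_Icc] at hi
      rw [mul_pow, ← mul_assoc, ← pow_mul]
      -- Since `m + 1 ≤ p` and `1 ≤ i`, each term gains at least one factor of `t` beyond `t ^ (m *
      -- n)`; cancelling that power leaves `t ∣ y ^ n`.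
      have hle : m * n + 1 ≤ p * i + m * (n - i) := by
        obtain ⟨j, rfl⟩ := Nat.exists_eq_add_of_le hi.2
        rw [Nat.add_sub_cancel_left]
        nlinarith [hi.1, Nat.mul_le_mul_right i hm]
      refine Dvd.dvd.mul_right ((pow_dvd_pow t hle).trans ?_) _
      rw [pow_add]
      exact mul_dvd_mul_right hai _
    rw [mul_pow, ← pow_mul, pow_succ] at hd
    have hy := ht.dvd_of_dvd_pow ((mul_dvd_mul_iff_left (pow_ne_zero _ ht.ne_zero)).mp hd)
    rw [pow_succ]
    exact mul_dvd_mul_left _ hy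

theorem IsIntegralOver.map {A B : Type*} [CommRing A] [CommRing B] (φ : A →+* B) {I : Ideal A}
    {J : Ideal B} (hIJ : I ≤ J.comap φ) {x : A} (hx : IsIntegralOver I x) :
    IsIntegralOver J (φ x) := by
  obtain ⟨n, hn, a, ha, h⟩ := hx
  refine ⟨n, hn, fun i => φ (a i), fun i hi => ?_, ?_⟩
  · exact Ideal.pow_right_mono (Ideal.map_le_iff_le_comap.mpr hIJ) i
      (Ideal.map_pow φ I i ▸ Ideal.mem_map_of_mem φ (ha i hi))
  · simpa using congrArg φ h

theorem isIntegralOver_of_mem {A : Type*} [CommRing A] {I : Ideal A} {x : A} (hx : x ∈ I) :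
    IsIntegralOver I x :=
  ⟨1, one_pos, fun _ => -x, by simpa using hx, by simp⟩

theorem le_mul_of_prime_pow_dvd_pow {A : Type*} [CommRing A] [IsDomain A] {t y : A}
    (ht : Prime t) (hy : ¬ t ∣ y) {p q m : ℕ} (h : t ^ p ∣ (t ^ m * y) ^ q) : p ≤ q * m := by
  rw [mul_pow, ← pow_mul] at h
  have := ht.pow_dvd_of_dvd_mul_right p (fun h' => hy (ht.dvd_of_dvd_pow h')) h
  rw [mul_comm q]
  exact (pow_dvd_pow_iff ht.ne_zero ht.not_isUnit).mp this

theorem le_mul_sum_of_mul_mem_ratPower {T : Finset σ} {I : Ideal (MvPolynomial σ k)}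
    (hIT : I ≤ Ideal.span (X '' (T : Set σ))) {u : ℚ} {s f : MvPolynomial σ k}
    (hs : s ∉ Ideal.span (X '' (T : Set σ))) (hsf : s * f ∈ ratPower I u)
    {a : σ →₀ ℕ} (ha : a ∈ f.support) : u.num.toNat ≤ u.den * ∑ i ∈ T, a i := by
  have hX := Polynomial.prime_X (R := MvPolynomial σ k)
  have hint : IsIntegralOver (I ^ u.num.toNat) ((s * f) ^ u.den) := hsf
  have hle : I ^ u.num.toNat ≤ Ideal.comap (gradingHom k T).toRingHom
      (Ideal.span {Polynomial.X ^ u.num.toNat}) := by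
    rw [← Ideal.map_le_iff_le_comap, Ideal.map_pow, ← Ideal.span_singleton_pow]
    refine Ideal.pow_right_mono (Ideal.map_le_iff_le_comap.mpr fun g hg => ?_) _
    exact Ideal.mem_span_singleton.mpr ((mem_span_X_image_iff_X_dvd T g).mp (hIT hg))
  have hdvd := (hint.map _ hle).prime_pow_dvd hX
  change _ ∣ gradingHom k T _ at hdvd
  rw [map_pow, map_mul, mul_pow] at hdvd
  rw [mem_span_X_image_iff_X_dvd] at hs
  replace hdvd := hX.pow_dvd_of_dvd_mul_left _ (fun h => hs (hX.dvd_of_dvd_pow h)) hdvd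
  have hf : gradingHom k T f ≠ 0 := by
    intro h0
    have := (X_pow_dvd_gradingHom_iff T f (∑ i ∈ T, a i + 1)).mp (h0 ▸ dvd_zero _) a ha
    omega
  -- Here `m` is the exact `t`-adic order of the image of `f`, hence at most the `T`-degree of every
  -- monomial of `f`.
  obtain ⟨m, y, hy, hfy⟩ := WfDvdMonoid.max_power_factor hf hX.irreducible
  rw [hfy] at hdvd
  refine (le_mul_of_prime_pow_dvd_pow hX hy hdvd).trans (Nat.mul_le_mul_left _ ?_)
  exact (X_pow_dvd_gradingHom_iff T f m).mp (hfy ▸ dvd_mul_right _ _) a ha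

end Order

/-! ### Associated primes of squarefree monomial ideals. -/

section Associated

variable {k : Type*} [Field k] {n : ℕ} {I : Ideal (MvPolynomial (Fin n) k)}

theorem IsSquarefreeMonomial.isRadical (hI : IsSquarefreeMonomial I) : I.IsRadical := by
  obtain ⟨S, hS, rfl⟩ := hI
  rintro f ⟨m, hm⟩
  rw [mem_ideal_span_monomial_image]
  intro a ha
  by_contra! hnot
  -- `T` collects the variables absent from `x^a`. A squarefree generator not dividing `x^a` must
  -- involve one of them, so `I` lies in a prime that `f` escapes because of its term at `a`.
  set T : Finset (Fin n) := {i | a i = 0} with hT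
  have hle : Ideal.span ((fun a => monomial a (1 : k)) '' S) ≤ Ideal.span (X '' (T : Set _)) := by
    rw [Ideal.span_le]
    rintro _ ⟨e, he, rfl⟩
    have := hnot e he
    rw [Finsupp.le_def] at this
    push Not at this
    obtain ⟨i, hi⟩ := this
    have hi1 := hS e he i
    refine mem_ideal_span_X_image.mpr fun b hb => ⟨i, ?_, ?_⟩
    · simp [hT]; omega
    · rw [Finset.mem_singleton.mp (support_monomial_subset hb)]; omega
  have hf := (span_X_image_isPrime T).mem_of_pow_mem m (hle hm)
  obtain ⟨i, hi, hi0⟩ := mem_ideal_span_X_image.mp hf a ha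
  simp [hT] at hi
  exact hi0 hi

/-- Write `P` as the annihilator of the class of `s`. If `s ∈ P` then `s² ∈ I`, so `s ∈ I` by
radicality and `P` is the unit ideal. With `T` the variables in `P`, each generator of `I` has a
factor in `T`; then `s g ∈ I ⊆ (X_T)` and `s ∉ (X_T)` force `g ∈ (X_T)`. -/
theorem IsSquarefreeMonomial.exists_of_mem_associatedPrimes (hI : IsSquarefreeMonomial I)
    {P : Ideal (MvPolynomial (Fin n) k)}
    (hP : P ∈ associatedPrimes (MvPolynomial (Fin n) k) (MvPolynomial (Fin n) k ⧸ I)) :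
    I ≤ P ∧ (∃ T : Finset (Fin n), P = Ideal.span (X '' (T : Set (Fin n)))) ∧
      ∃ s ∉ P, ∀ g ∈ P, s * g ∈ I := by
  classical
  obtain ⟨hprime, x, hx⟩ := isAssociatedPrime_iff.mp hP
  obtain ⟨s, rfl⟩ := Ideal.Quotient.mk_surjective x
  have hmem : ∀ g, g ∈ P ↔ s * g ∈ I := by
    intro g
    rw [hx, Submodule.mem_colon_singleton, Submodule.mem_bot, ← Ideal.Quotient.eq_zero_iff_mem,
      mul_comm, map_mul]
    rfl
  have hIP : I ≤ P := fun g hg => (hmem g).mpr (I.mul_mem_left _ hg)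
  have hs : s ∉ P := by
    intro h
    have hsI : s ∈ I := hI.isRadical ⟨2, by rw [sq]; exact (hmem s).mp h⟩
    exact hprime.ne_top ((Ideal.eq_top_iff_one _).mpr ((hmem 1).mpr (by simpa using hsI)))
  refine ⟨hIP, ⟨({i | X i ∈ P} : Finset (Fin n)), ?_⟩, s, hs, fun g hg => (hmem g).mp hg⟩
  set T : Finset (Fin n) := {i | X i ∈ P} with hT
  have hTP : Ideal.span (X '' (T : Set (Fin n))) ≤ P := by
    rw [Ideal.span_le]
    rintro _ ⟨i, hi, rfl⟩
    simpa [hT] using hi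
  have hIT : I ≤ Ideal.span (X '' (T : Set (Fin n))) := by
    obtain ⟨S, -, rfl⟩ := hI
    rw [Ideal.span_le]
    rintro _ ⟨e, he, rfl⟩
    have heP := hIP (Ideal.subset_span ⟨e, he, rfl⟩)
    simp only [monomial_eq, map_one, one_mul, Finsupp.prod] at heP
    obtain ⟨i, hi, hiP⟩ := hprime.prod_mem_iff.mp heP
    refine mem_ideal_span_X_image.mpr fun b hb => ⟨i, ?_, ?_⟩
    · simpa [hT] using hprime.mem_of_pow_mem _ hiP
    · rw [Finset.mem_singleton.mp (support_monomial_subset hb)]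
      exact Finsupp.mem_support_iff.mp hi
  refine le_antisymm (fun g hg => ?_) hTP
  exact ((span_X_image_isPrime T).mem_or_mem (hIT ((hmem g).mp hg))).resolve_left
    fun h => hs (hTP h)

end Associated

/-! ### Newton polyhedra of coordinate primes. -/

section Newton

variable {k : Type*} [Field k] {n : ℕ}

theorem monomial_mem_span_X_image_iff (T : Finset (Fin n)) (a : Fin n →₀ ℕ) :
    monomial a (1 : k) ∈ Ideal.span (X '' (T : Set (Fin n))) ↔ 1 ≤ ∑ i ∈ T, a i := by
  classical
  rw [mem_span_X_image_iff_X_dvd, ← pow_one (Polynomial.X : Polynomial (MvPolynomial (Fin n) k)),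
    X_pow_dvd_gradingHom_iff]
  simp [support_monomial]

theorem sum_expVec (T : Finset (Fin n)) (a : Fin n →₀ ℕ) :
    ∑ i ∈ T, expVec a i = ((∑ i ∈ T, a i : ℕ) : ℝ) := by
  simp [expVec]

/-- The nonnegative orthant is the convex hull of its lattice points. -/
theorem mem_convexHull_range_expVec {v : Fin n → ℝ} (hv : ∀ i, 0 ≤ v i) :
    v ∈ convexHull ℝ (Set.range (expVec (n := n))) := by
  have hrange : Set.range (expVec (n := n)) =
      Set.univ.pi fun _ => Set.range (Nat.cast : ℕ → ℝ) := by
    ext w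
    simp only [Set.mem_range, Set.mem_univ_pi]
    constructor
    · rintro ⟨a, rfl⟩ i
      exact ⟨a i, rfl⟩
    · intro h
      choose b hb using h
      exact ⟨Finsupp.equivFunOnFinite.symm b, funext fun i => by simp [expVec, hb]⟩
  rw [hrange]
  refine mem_convexHull_pi fun i _ => ?_
  obtain ⟨m, hm⟩ := exists_nat_ge (v i)
  have h0 : (0 : ℝ) ∈ Set.range (Nat.cast : ℕ → ℝ) := ⟨0, Nat.cast_zero⟩
  refine segment_subset_convexHull h0 ⟨m, rfl⟩ ?_
  rw [segment_eq_Icc (Nat.cast_nonneg m)]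
  exact ⟨hv i, hm⟩

theorem mem_newtonPolyhedron_span_X_image_iff (T : Finset (Fin n)) (v : Fin n → ℝ) :
    v ∈ newtonPolyhedron (Ideal.span (X '' (T : Set (Fin n))) : Ideal (MvPolynomial (Fin n) k)) ↔
      (∀ i, 0 ≤ v i) ∧ 1 ≤ ∑ i ∈ T, v i := by
  classical
  set A : Set (Fin n → ℝ) := expVec '' {a | monomial a (1 : k) ∈ Ideal.span (X '' (T : Set (Fin n)))}
    with hA
  change v ∈ convexHull ℝ A ↔ _
  constructor
  · have hconv : Convex ℝ {v : Fin n → ℝ | (∀ i, 0 ≤ v i) ∧ 1 ≤ ∑ i ∈ T, v i} := by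
      rintro x ⟨hx0, hx1⟩ y ⟨hy0, hy1⟩ α β hα hβ hαβ
      refine ⟨fun i => ?_, ?_⟩
      · have := hx0 i
        have := hy0 i
        simp only [Pi.add_apply, Pi.smul_apply, smul_eq_mul]
        positivity
      · simp only [Pi.add_apply, Pi.smul_apply, smul_eq_mul, Finset.sum_add_distrib,
          ← Finset.mul_sum]
        nlinarith
    refine fun hv => convexHull_min ?_ hconv hv
    rintro _ ⟨a, ha, rfl⟩
    refine ⟨fun i => Nat.cast_nonneg _, ?_⟩
    rw [sum_expVec]
    exact_mod_cast (monomial_mem_span_X_image_iff T a).mp ha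
  · rintro ⟨hv0, hv1⟩
    have hadd : A + Set.range expVec ⊆ A := by
      rintro _ ⟨_, ⟨a, ha, rfl⟩, _, ⟨b, rfl⟩, rfl⟩
      refine ⟨a + b, ?_, by ext i; simp [expVec]⟩
      have ha' := (monomial_mem_span_X_image_iff T a).mp ha
      refine (monomial_mem_span_X_image_iff T _).mpr (ha'.trans (Finset.sum_le_sum fun i _ => ?_))
      simp
    have hc : 0 < ∑ i ∈ T, v i := by linarith
    set c := ∑ i ∈ T, v i with hcdef
    -- The `T`-part of `v`, rescaled to coordinate sum 1, is a convex combination of unit vectors.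
    -- As `c ≥ 1`, the remainder `v - w` stays in the orthant and is absorbed through `A + ℕⁿ ⊆ A`.
    set w : Fin n → ℝ := ∑ i ∈ T, (v i / c) • expVec (Finsupp.single i 1) with hw
    have hwA : w ∈ convexHull ℝ A := by
      refine (convex_convexHull ℝ A).sum_mem (fun i _ => div_nonneg (hv0 i) hc.le) ?_ ?_
      · rw [← Finset.sum_div, div_self hc.ne']
      · intro i hi
        refine subset_convexHull ℝ A ⟨_, Ideal.subset_span ⟨i, hi, rfl⟩, rfl⟩
    have hwapp : ∀ j, w j = if j ∈ T then v j / c else 0 := by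
      intro j
      simp [hw, expVec, Finsupp.single_apply]
    have hvw : ∀ j, 0 ≤ (v - w) j := by
      intro j
      rw [Pi.sub_apply, hwapp, sub_nonneg]
      split_ifs
      · exact div_le_self (hv0 j) hv1
      · exact hv0 j
    refine convexHull_mono hadd ?_
    rw [convexHull_add]
    exact ⟨w, hwA, v - w, mem_convexHull_range_expVec hvw, by simp⟩

end Newton

/-! ### Comparison of the two ideals. -/

section Main

variable {k : Type*} [Field k] {n : ℕ} {I : Ideal (MvPolynomial (Fin n) k)}

theorem expVec_mem_smul_symbolicPolyhedron_iff (hI : IsSquarefreeMonomial I) {u : ℚ} (hu : 0 < u)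
    (a : Fin n →₀ ℕ) : expVec a ∈ (u : ℝ) • symbolicPolyhedron I ↔
      ∀ T : Finset (Fin n), Ideal.span (X '' (T : Set (Fin n))) ∈
        associatedPrimes (MvPolynomial (Fin n) k) (MvPolynomial (Fin n) k ⧸ I) →
        u.num.toNat ≤ u.den * ∑ i ∈ T, a i := by
  have hu' : (0 : ℝ) < u := by exact_mod_cast hu
  have hnn : ∀ i, 0 ≤ ((u : ℝ)⁻¹ • expVec a) i := fun i =>
    mul_nonneg (inv_nonneg.mpr hu'.le) (Nat.cast_nonneg _)
  have key : ∀ T : Finset (Fin n), 1 ≤ ∑ i ∈ T, ((u : ℝ)⁻¹ • expVec a) i ↔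
      u.num.toNat ≤ u.den * ∑ i ∈ T, a i := by
    intro T
    have hnum : ((u.num.toNat : ℤ) : ℝ) = (u.num : ℝ) := by
      rw [Int.toNat_of_nonneg (Rat.num_nonneg.mpr hu.le)]
    have hden : (0 : ℝ) < u.den := by exact_mod_cast u.den_pos
    simp only [Pi.smul_apply, smul_eq_mul]
    rw [← Finset.mul_sum, sum_expVec, inv_mul_eq_div, one_le_div hu', Rat.cast_def,
      div_le_iff₀' hden, ← hnum]
    exact_mod_cast Iff.rfl
  rw [Set.mem_smul_set_iff_inv_smul_mem₀ hu'.ne']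
  constructor
  · rintro ⟨-, h⟩ T hT
    exact (key T).mp ((mem_newtonPolyhedron_span_X_image_iff T _).mp (h _ hT)).2
  · refine fun h => ⟨hnn, fun P hP => ?_⟩
    obtain ⟨-, ⟨T, rfl⟩, -⟩ := hI.exists_of_mem_associatedPrimes hP
    exact (mem_newtonPolyhedron_span_X_image_iff T _).mpr ⟨hnn, (key T).mpr (h T hP)⟩

/-- Clearing denominators removes the localizations, so both inclusions become computations in the
ring itself. -/
theorem mem_ratSymbolicPower_iff {R : Type*} [CommRing R] (J : Ideal R) (u : ℚ) (f : R) :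
    f ∈ ratSymbolicPower J u ↔ ∀ P ∈ associatedPrimes R (R ⧸ J),
      ∃ s ∉ P, s * f ∈ ratPower J u := by
  simp only [ratSymbolicPower, Submodule.mem_iInf, Ideal.mem_comap]
  refine forall_congr' fun P => ⟨fun h hP => ?_, fun h _ hP => ?_⟩
  · have := hP.isPrime
    obtain ⟨s, hs, hsf⟩ :=
      (IsLocalization.algebraMap_mem_map_algebraMap_iff P.primeCompl _ _ _).mp (h hP.isPrime hP)
    exact ⟨s, hs, hsf⟩
  · obtain ⟨s, hs, hsf⟩ := h hP
    exact (IsLocalization.algebraMap_mem_map_algebraMap_iff P.primeCompl _ _ _).mpr ⟨s, hs, hsf⟩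

theorem monomial_mem_span_X_image_pow (T : Finset (Fin n)) (a : Fin n →₀ ℕ) :
    monomial a (1 : k) ∈ Ideal.span (X '' (T : Set (Fin n))) ^ (∑ i ∈ T, a i) := by
  classical
  rw [monomial_eq, map_one, one_mul, Finsupp.prod_fintype _ _ (by simp),
    ← Finset.prod_mul_prod_compl T]
  refine Ideal.mul_mem_right _ _ ?_
  rw [← Finset.prod_pow_eq_pow_sum]
  exact Ideal.prod_mem_prod fun i hi =>
    Ideal.pow_mem_pow (Ideal.subset_span (Set.mem_image_of_mem X hi)) _

/-- The element already lies in `J ^ m`, so its `u.den`-th power is in `J ^ u.num.toNat` itself,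
with no need of integral closure. -/
theorem pow_mul_mem_ratPower {R : Type*} [CommRing R] {J P : Ideal R} {s x : R}
    (hs : ∀ g ∈ P, s * g ∈ J) {m : ℕ} (hx : x ∈ P ^ m) {u : ℚ} (hm : u.num.toNat ≤ u.den * m) :
    s ^ m * x ∈ ratPower J u := by
  have hle : Ideal.span {s} * P ≤ J := by
    rw [Ideal.span_singleton_mul_le_iff]
    exact hs
  have hmem : s ^ m * x ∈ J ^ m := by
    refine Ideal.pow_right_mono hle m ?_
    rw [mul_pow, Ideal.span_singleton_pow]
    exact Ideal.mul_mem_mul (Ideal.mem_span_singleton_self _) hx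
  refine isIntegralOver_of_mem (Ideal.pow_le_pow_right hm ?_)
  rw [mul_comm, pow_mul]
  exact Ideal.pow_mem_pow hmem _

end Main

end RatSymb

theorem mainTheorem6 {k : Type*} [Field k] (n : ℕ) (I : Ideal (MvPolynomial (Fin n) k))
    (hI : RatSymb.IsSquarefreeMonomial I) (u : ℚ) (hu : 0 < u) :
    RatSymb.ratSymbolicPower I u =
      Ideal.span {f : MvPolynomial (Fin n) k | ∃ a : Fin n →₀ ℕ,
        RatSymb.expVec a ∈ (u : ℝ) • RatSymb.symbolicPolyhedron I ∧
        f = MvPolynomial.monomial a 1} := by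
  refine le_antisymm (fun f hf => ?_) ?_
  · rw [RatSymb.mem_ratSymbolicPower_iff] at hf
    rw [f.as_sum]
    refine Ideal.sum_mem _ fun a ha => ?_
    rw [← mul_one (f.coeff a), ← MvPolynomial.C_mul_monomial]
    refine Ideal.mul_mem_left _ _ (Ideal.subset_span ⟨a, ?_, rfl⟩)
    rw [RatSymb.expVec_mem_smul_symbolicPolyhedron_iff hI hu]
    intro T hT
    obtain ⟨s, hs, hsf⟩ := hf _ hT
    exact RatSymb.le_mul_sum_of_mul_mem_ratPower (hI.exists_of_mem_associatedPrimes hT).1 hs hsf ha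
  · rw [Ideal.span_le]
    rintro _ ⟨a, ha, rfl⟩
    rw [RatSymb.expVec_mem_smul_symbolicPolyhedron_iff hI hu] at ha
    refine (RatSymb.mem_ratSymbolicPower_iff I u _).mpr fun P hP => ?_
    obtain ⟨-, ⟨T, rfl⟩, s, hs, hsP⟩ := hI.exists_of_mem_associatedPrimes hP
    -- The exponent of `s` is the `T`-degree of `a`.
    exact ⟨s ^ _, fun h => hs (hP.isPrime.mem_of_pow_mem _ h),
      RatSymb.pow_mul_mem_ratPower hsP (RatSymb.monomial_mem_span_X_image_pow T a) (ha T hP)⟩
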